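/- Let $\mathbb F$ be a field, $d\ge 0$ an integer, and $V$ a vector space over $\mathbb F$ of dimension $d+1$. An element of $\mathrm{End}(V)$ is multiplicity-free if it has $d+1$ mutually distinct eigenvalues in $\mathbb F$; its primitive idempotents are the projections onto its eigenspaces along the sum of the others. A Leonard system on $V$ is a sequence $(A;\{E_i\}_{i=0}^d;A^*;\{E_i^*\}_{i=0}^d)$ in which $A,A^*\in\mathrm{End}(V)$ are multiplicity-free, $\{E_i\}_{i=0}^d$ and $\{E_i^*\}_{i=0}^d$ are orderings of the primitive idempotents of $A$ and of $A^*$ respectively, and, for $0\le i,j\le d$, each of $E_i^*AE_j^*$ and $E_iA^*E_j$ is zero if $|i-j|>1$ and nonzero if $|i-j|=1$. It is bipartite if $\mathrm{tr}(E_i^*A)=0$ for $0\le i\le d$. Let $\theta_i$ (resp. $\theta_i^*$) be the eigenvalue of $A$ (resp. $A^*$) associated with the eigenspace $E_iV$ (resp. $E_i^*V$). For every bipartite Leonard system $(A;\{E_i\}_{i=0}^d;A^*;\{E_i^*\}_{i=0}^d)$ on $V$: (i) $$\theta_i(\theta^*_{d-i-1}-\theta^*_{i+1})=\theta_{i+1}(\theta^*_{d-i}-\theta^*_i)\qquad(0\le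 i\le d-1).$$ (ii) Consequently the eigenvalues $\theta_i$ can be computed recursively from the $\theta_i^*$ and one nonzero $\theta_j$. Precisely, let $0\le j\le d$ with $\theta_j\ne 0$. Start from the value $\theta_j$ at the index $j$ and apply the following steps repeatedly, in any order: from a value $y$ at $i$ $(0\le i\le d)$ obtain the value $-y$ at $d-i$; for $0\le i\le d-1$, from a value $y$ at $i$ obtain the value $y\,\dfrac{\theta^*_{d-i-1}-\theta^*_{i+1}}{\theta^*_{d-i}-\theta^*_i}$ at $i+1$, provided $\theta^*_{d-i}\neq\theta^*_i$; and for $0\le i\le d-1$, from a value $y$ at $i+1$ obtain the value $y\,\dfrac{\theta^*_{d-i}-\theta^*_i}{\theta^*_{d-i-1}-\theta^*_{i+1}}$ at $i$, provided $\theta^*_{d-i-1}\ne\theta^*_{i+1}$. Then for every $0\le i\le d$ some finite sequence of steps yields a value at $i$, and every value so obtained at $i$ equals $\theta_i$. -/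

import Mathlib

namespace Leonard

variable {F V : Type*} [Field F] [AddCommGroup V] [Module F V]

/-- `A` has `d + 1` mutually distinct eigenvalues in `F` (used for `dim V = d + 1`). -/
def MultiplicityFree (d : ℕ) (A : Module.End F V) : Prop :=
  ∃ θ : Fin (d + 1) → F, Function.Injective θ ∧ ∀ i, A.HasEigenvalue (θ i)

/-- `E₀, …, E_d` is an ordering of the primitive idempotents of `A`: for some ordering
`θ₀, …, θ_d` of the (distinct) eigenvalues of `A`, the map `E i` is the identity on the
eigenspace of `θ i` and vanishes on the eigenspaces of the other `θ j`. -/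
def IsPrimitiveIdempotents {d : ℕ} (A : Module.End F V) (E : Fin (d + 1) → Module.End F V) :
    Prop :=
  ∃ θ : Fin (d + 1) → F, Function.Injective θ ∧ (∀ i, A.HasEigenvalue (θ i)) ∧
    (∀ i, ∀ v ∈ A.eigenspace (θ i), E i v = v) ∧
    (∀ i j, i ≠ j → ∀ v ∈ A.eigenspace (θ j), E i v = 0)

/-- `E i * B * E j` is zero if `|i - j| > 1` and nonzero if `|i - j| = 1`. -/
def ActsIrredTridiagonally {d : ℕ} (E : Fin (d + 1) → Module.End F V) (B : Module.End F V) :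
    Prop :=
  (∀ i j : Fin (d + 1), 1 < |(i : ℤ) - (j : ℤ)| → E i * B * E j = 0) ∧
  (∀ i j : Fin (d + 1), |(i : ℤ) - (j : ℤ)| = 1 → E i * B * E j ≠ 0)

/-- `(A; E; A*; E*)` is a Leonard system on the `(d + 1)`-dimensional space `V`. -/
structure IsLeonardSystem {d : ℕ} (A : Module.End F V) (E : Fin (d + 1) → Module.End F V)
    (As : Module.End F V) (Es : Fin (d + 1) → Module.End F V) : Prop where
  finrank_eq : Module.finrank F V = d + 1
  multiplicityFree : MultiplicityFree d A
  multiplicityFree_star : MultiplicityFree d As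
  idempotents : IsPrimitiveIdempotents A E
  idempotents_star : IsPrimitiveIdempotents As Es
  tridiagonal : ActsIrredTridiagonally Es A
  tridiagonal_star : ActsIrredTridiagonally E As

/-- All the intersection numbers `a i = tr (E*_i A)` vanish. -/
def IsBipartite {d : ℕ} (A : Module.End F V) (Es : Fin (d + 1) → Module.End F V) : Prop :=
  ∀ i, LinearMap.trace F V (Es i * A) = 0

/-- The subspace `W` is an eigenspace of `A`, and `t` is the eigenvalue associated with it. -/
def IsEigenvalueOf (A : Module.End F V) (W : Submodule F V) (t : F) : Prop :=
  W ≠ ⊥ ∧ W = A.eigenspace t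

/-- `RecComputes θs j x i y`: starting from the value `x` at the index `j`, the value `y` at the
index `i` is obtained in finitely many steps, each of which uses only the scalars `θs`: a step
either passes from `i` to `d - i` by a change of sign, or solves the relation
`θ i * (θs (d-i-1) - θs (i+1)) = θ (i+1) * (θs (d-i) - θs i)` for one of `θ (i+1)`, `θ i`,
given the other one, when its coefficient is nonzero. Here `Fin.rev i` is the index `d - i`. -/
inductive RecComputes {d : ℕ} (θs : Fin (d + 1) → F) (j : Fin (d + 1)) (x : F) :
    Fin (d + 1) → F → Prop
  | start : RecComputes θs j x j x
  | reflect (i : Fin (d + 1)) (y : F) : RecComputes θs j x i y → RecComputes θs j x i.rev (-y)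
  | up (i : Fin d) (y : F) : RecComputes θs j x i.castSucc y →
      θs i.castSucc.rev - θs i.castSucc ≠ 0 →
      RecComputes θs j x i.succ
        (y * (θs i.succ.rev - θs i.succ) / (θs i.castSucc.rev - θs i.castSucc))
  | down (i : Fin d) (y : F) : RecComputes θs j x i.succ y →
      θs i.succ.rev - θs i.succ ≠ 0 →
      RecComputes θs j x i.castSucc
        (y * (θs i.castSucc.rev - θs i.castSucc) / (θs i.succ.rev - θs i.succ))

end Leonard

/-!
In the split basis `A` is lower bidiagonal with diagonal `θ_i` and `A*` is upper bidiagonal with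
diagonal `θ*_i`. Comparing diagonals with those in the eigenbases, the partial sums of `a_h - θ_h`
and of `a*_h - θ*_h`, where `a_h = tr(E*_h A)` and `a*_h = tr(E_h A*)`, both produce the same
entry `φ_{i+1}`, so that
`(∑_{h ≤ i} (a_h - θ_h)) (θ*_i - θ*_{i+1}) = φ_{i+1} = (∑_{h ≤ i} (a*_h - θ*_h)) (θ_i - θ_{i+1})`.
In the bipartite case `a_h = 0`, and reversing the order of the `E*_h` changes neither `a_h` nor
`a*_h`. Subtracting the equations for the two orderings gives a recursion that forces
`θ*_{d-i} - θ*_i = c θ_i` for a constant `c ≠ 0`. Both claims follow: since the `θ*_i` are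
distinct, the only index at which a coefficient can vanish is the middle one, where `θ_i = 0`.
-/

namespace Leonard

open Module Matrix

section Matrices

variable {ι R : Type*} [LinearOrder ι]

/-- An upper Hessenberg matrix: entries strictly below the first subdiagonal vanish. In order
terms, `M a b` can be nonzero only if `a ≤ b` or `a` covers `b`. -/
def IsUpperHessenberg [Zero R] (M : Matrix ι ι R) : Prop :=
  ∀ ⦃a b c⦄, b < c → c < a → M a b = 0

variable [Fintype ι] [CommRing R] {M N T T' X : Matrix ι ι R} {i j : ι}

theorem mul_apply_self_of_isUpperTriangular (hM : M.IsUpperTriangular) (hN : N.IsUpperTriangular)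
    (a : ι) : (M * N) a a = M a a * N a a := by
  rw [Matrix.mul_apply, Finset.sum_eq_single_of_mem a (Finset.mem_univ a)]
  intro b _ hb
  rcases hb.lt_or_gt with h | h
  · rw [hM h, zero_mul]
  · rw [hN h, mul_zero]

theorem mul_apply_of_covBy (hM : M.IsUpperTriangular) (hN : N.IsUpperTriangular) (hij : i ⋖ j) :
    (M * N) i j = M i i * N i j + M i j * N j j := by
  rw [Matrix.mul_apply]
  refine Finset.sum_eq_add_of_mem i j (Finset.mem_univ i) (Finset.mem_univ j) hij.lt.ne ?_
  rintro b - ⟨hbi, hbj⟩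
  rcases hbi.lt_or_gt with h | h
  · rw [hM h, zero_mul]
  · rw [hN ((hij.ge_of_gt h).lt_of_ne' hbj), mul_zero]

theorem IsUpperHessenberg.mul_left (hX : IsUpperHessenberg X) (hT : T.IsUpperTriangular) :
    IsUpperHessenberg (T * X) := by
  intro a b c hbc hca
  rw [Matrix.mul_apply]
  refine Finset.sum_eq_zero fun e _ => ?_
  rcases lt_or_ge e a with h | h
  · rw [hT h, zero_mul]
  · rw [hX hbc (hca.trans_le h), mul_zero]

theorem IsUpperHessenberg.mul_left_apply_of_covBy (hX : IsUpperHessenberg X)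
    (hT : T.IsUpperTriangular) (hij : i ⋖ j) : (T * X) j i = T j j * X j i := by
  rw [Matrix.mul_apply, Finset.sum_eq_single_of_mem j (Finset.mem_univ j)]
  intro e _ he
  rcases he.lt_or_gt with h | h
  · rw [hT h, zero_mul]
  · rw [hX hij.lt h, mul_zero]

theorem IsUpperHessenberg.mul_right_apply_of_covBy (hX : IsUpperHessenberg X)
    (hT : T.IsUpperTriangular) (hij : i ⋖ j) : (X * T) j i = X j i * T i i := by
  rw [Matrix.mul_apply, Finset.sum_eq_single_of_mem i (Finset.mem_univ i)]
  intro e _ he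
  rcases he.lt_or_gt with h | h
  · rw [hX h hij.lt, zero_mul]
  · rw [hT h, mul_zero]

/-- The coordinate projection onto the initial segment of indices `≤ i`. -/
def initialProjection (R : Type*) [CommRing R] (i : ι) : Matrix ι ι R :=
  diagonal fun h => if h ≤ i then 1 else 0

theorem trace_initialProjection_mul [LocallyFiniteOrderBot ι] (i : ι) (M : Matrix ι ι R) :
    (initialProjection R i * M).trace = ∑ h ∈ Finset.Iic i, M h h := by
  simp only [initialProjection, trace, diag_apply, diagonal_mul, ite_mul, one_mul, zero_mul,
    ← Finset.mem_Iic, Finset.sum_ite_mem, Finset.univ_inter]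

-- The commutator is supported on the rows `≤ i` and the columns `> i`, a block whose transpose
-- meets a Hessenberg matrix in a single entry.
theorem trace_initialProjection_commutator_mul (hT : T.IsUpperTriangular)
    (hX : IsUpperHessenberg X) (hij : i ⋖ j) :
    ((initialProjection R i * T - T * initialProjection R i) * X).trace = T i j * X j i := by
  have entry (a b : ι) : (initialProjection R i * T - T * initialProjection R i) a b =
      if a ≤ i ∧ i < b then T a b else 0 := by
    rw [initialProjection, Matrix.sub_apply, diagonal_mul, mul_diagonal]
    rcases le_or_gt a i with ha | ha <;> rcases le_or_gt b i with hb | hb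
    · simp [ha, hb]
    · simp [ha, hb]
    · simp [hb, hT (hb.trans_lt ha)]
    · simp [ha.not_ge, hb.not_ge]
  have term_eq_zero (a b : ι) (hab : ¬(a = i ∧ b = j)) :
      (initialProjection R i * T - T * initialProjection R i) a b * X b a = 0 := by
    rw [entry]
    split_ifs with h
    · have : X b a = 0 := by
        by_cases hai : a = i
        · exact hX (hai ▸ hij.lt) ((hij.ge_of_gt h.2).lt_of_ne' fun hb => hab ⟨hai, hb⟩)
        · exact hX (h.1.lt_of_ne hai) h.2
      rw [this, mul_zero]
    · exact zero_mul _
  simp only [trace, diag_apply, Matrix.mul_apply (M := _ - _)]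
  rw [Finset.sum_eq_single_of_mem i (Finset.mem_univ i) fun a _ ha =>
      Finset.sum_eq_zero fun b _ => term_eq_zero a b fun h => ha h.1,
    Finset.sum_eq_single_of_mem j (Finset.mem_univ j) fun b _ hb =>
      term_eq_zero i b fun h => hb h.2,
    entry, if_pos ⟨le_rfl, hij.lt⟩]

section Conjugation

variable (hT : T.IsUpperTriangular) (hTT' : T * T' = 1)
include hT hTT'

theorem isUpperTriangular_of_mul_eq_one : T'.IsUpperTriangular := by
  have := invertibleOfRightInverse T T' hTT'
  rw [← inv_eq_right_inv hTT']
  exact blockTriangular_inv_of_blockTriangular hT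

theorem apply_self_mul_apply_self_of_mul_eq_one (a : ι) : T a a * T' a a = 1 := by
  have hT' := isUpperTriangular_of_mul_eq_one hT hTT'
  rw [← mul_apply_self_of_isUpperTriangular hT hT', hTT', one_apply_eq]

theorem conj_diagonal_apply_self (y : ι → R) (a : ι) :
    (T' * diagonal y * T) a a = y a := by
  have hT' := isUpperTriangular_of_mul_eq_one hT hTT'
  have hdiag := apply_self_mul_apply_self_of_mul_eq_one hT hTT' a
  rw [mul_apply_self_of_isUpperTriangular (hT'.mul (blockTriangular_diagonal y)) hT, mul_diagonal]
  linear_combination y a * hdiag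

theorem sub_mul_apply_eq_mul_conj_diagonal_apply (y : ι → R) (hij : i ⋖ j) :
    (y i - y j) * T i j = T i i * (T' * diagonal y * T) i j := by
  have hT' := isUpperTriangular_of_mul_eq_one hT hTT'
  have hY : (T' * diagonal y * T).IsUpperTriangular :=
    (hT'.mul (blockTriangular_diagonal y)).mul hT
  have intertwine : T * (T' * diagonal y * T) = diagonal y * T := by
    rw [← mul_assoc, ← mul_assoc, hTT', one_mul]
  have hentry := mul_apply_of_covBy hT hY hij
  rw [intertwine, diagonal_mul, conj_diagonal_apply_self hT hTT'] at hentry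
  linear_combination hentry

theorem IsUpperHessenberg.sum_diag_sub_sum_diag_conj [LocallyFiniteOrderBot ι]
    (hX : IsUpperHessenberg X) (hij : i ⋖ j) :
    ∑ h ∈ Finset.Iic i, X h h - ∑ h ∈ Finset.Iic i, (T' * X * T) h h = T i j * (T' * X) j i := by
  have hT' := isUpperTriangular_of_mul_eq_one hT hTT'
  rw [← trace_initialProjection_commutator_mul hT (hX.mul_left hT') hij,
    ← trace_initialProjection_mul, ← trace_initialProjection_mul, Matrix.sub_mul, trace_sub]
  congr 1
  · rw [mul_assoc, ← mul_assoc T, hTT', one_mul]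
  · rw [← mul_assoc, trace_mul_comm, ← mul_assoc]

theorem IsUpperHessenberg.sum_diag_sub_sum_diag_conj_mul [LocallyFiniteOrderBot ι]
    (hX : IsUpperHessenberg X) (y : ι → R) (hij : i ⋖ j) :
    (∑ h ∈ Finset.Iic i, X h h - ∑ h ∈ Finset.Iic i, (T' * X * T) h h) * (y i - y j) =
      (T' * X * T) j i * (T' * diagonal y * T) i j := by
  have hT' := isUpperTriangular_of_mul_eq_one hT hTT'
  rw [hX.sum_diag_sub_sum_diag_conj hT hTT' hij,
    (hX.mul_left hT').mul_right_apply_of_covBy hT hij]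
  linear_combination (T' * X) j i * sub_mul_apply_eq_mul_conj_diagonal_apply hT hTT' y hij

theorem IsUpperHessenberg.conj_apply_ne_zero [NoZeroDivisors R] [Nontrivial R]
    (hX : IsUpperHessenberg X) (hij : i ⋖ j) (hne : X j i ≠ 0) : (T' * X * T) j i ≠ 0 := by
  have hT' := isUpperTriangular_of_mul_eq_one hT hTT'
  have hdiag := apply_self_mul_apply_self_of_mul_eq_one hT hTT'
  rw [(hX.mul_left hT').mul_right_apply_of_covBy hT hij, hX.mul_left_apply_of_covBy hT' hij]
  exact mul_ne_zero (mul_ne_zero (right_ne_zero_of_mul_eq_one (hdiag j)) hne)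
    (left_ne_zero_of_mul_eq_one (hdiag i))

end Conjugation

end Matrices

section SplitBasis

variable {F V : Type*} [Field F] [AddCommGroup V] [Module F V] {d : ℕ}

theorem castSucc_covBy_succ (i : Fin d) : i.castSucc ⋖ i.succ :=
  Fin.covBy_iff.2 (Order.covBy_add_one i.val)

/-- The split vectors `u₀ = x`, `u_{i+1} = (A - θ_i) u_i` of Terwilliger. When `x` spans `E*_0 V`,
the vector `u_i` lies in `(E*_0 V + ⋯ + E*_i V) ∩ (E_i V + ⋯ + E_d V)`. -/
def splitVector (A : End F V) (θ : Fin (d + 1) → F) (x : V) : Fin (d + 1) → V :=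
  Fin.induction x fun i y => A y - θ i.castSucc • y

theorem splitVector_zero (A : End F V) (θ : Fin (d + 1) → F) (x : V) :
    splitVector A θ x 0 = x :=
  rfl

theorem splitVector_succ (A : End F V) (θ : Fin (d + 1) → F) (x : V) (i : Fin d) :
    splitVector A θ x i.succ =
      A (splitVector A θ x i.castSucc) - θ i.castSucc • splitVector A θ x i.castSucc :=
  rfl

theorem repr_splitVector_eq_zero_of_lt {A : End F V} {θ : Fin (d + 1) → F}
    {v : Basis (Fin (d + 1)) F V} (hv : LinearMap.toMatrix v v A = diagonal θ) (x : V)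
    (i a : Fin (d + 1)) (hai : a < i) : v.repr (splitVector A θ x i) a = 0 := by
  induction i using Fin.induction with
  | zero => exact absurd hai (Fin.not_lt_zero a)
  | succ i ih =>
    rw [splitVector_succ, map_sub, Finsupp.sub_apply, ← LinearMap.toMatrix_mulVec_repr v v, hv,
      mulVec_diagonal, map_smul, Finsupp.smul_apply, smul_eq_mul]
    rcases (Fin.le_castSucc_iff.2 hai).eq_or_lt with rfl | h
    · exact sub_self _
    · rw [ih h, mul_zero, mul_zero, sub_zero]

theorem repr_splitVector_eq_zero_of_gt {A : End F V} {w : Basis (Fin (d + 1)) F V}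
    (hA : IsUpperHessenberg (LinearMap.toMatrix w w A)) (θ : Fin (d + 1) → F)
    (i a : Fin (d + 1)) (hia : i < a) : w.repr (splitVector A θ (w 0) i) a = 0 := by
  induction i using Fin.induction generalizing a with
  | zero => rw [splitVector_zero, w.repr_self, Finsupp.single_eq_of_ne hia.ne']
  | succ i ih =>
    have hi : i.castSucc < a := Fin.castSucc_lt_succ.trans hia
    rw [splitVector_succ, map_sub, Finsupp.sub_apply, ← LinearMap.toMatrix_mulVec_repr w w,
      map_smul, Finsupp.smul_apply, ih a hi, smul_zero, sub_zero, mulVec, dotProduct]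
    refine Finset.sum_eq_zero fun b _ => ?_
    rcases le_or_gt b i.castSucc with hb | hb
    · rw [hA (Fin.le_castSucc_iff.1 hb) hia, zero_mul]
    · rw [ih b hb, mul_zero]

theorem repr_splitVector_self_ne_zero {A : End F V} {w : Basis (Fin (d + 1)) F V}
    (hA : IsUpperHessenberg (LinearMap.toMatrix w w A))
    (hne : ∀ i j, i ⋖ j → LinearMap.toMatrix w w A j i ≠ 0) (θ : Fin (d + 1) → F)
    (i : Fin (d + 1)) : w.repr (splitVector A θ (w 0) i) i ≠ 0 := by
  induction i using Fin.induction with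
  | zero => simp [splitVector_zero]
  | succ i ih =>
    rw [splitVector_succ, map_sub, Finsupp.sub_apply, ← LinearMap.toMatrix_mulVec_repr w w,
      map_smul, Finsupp.smul_apply, repr_splitVector_eq_zero_of_gt hA θ _ _ Fin.castSucc_lt_succ,
      smul_zero, sub_zero, mulVec, dotProduct,
      Finset.sum_eq_single_of_mem i.castSucc (Finset.mem_univ _)]
    · exact mul_ne_zero (hne _ _ (castSucc_covBy_succ i)) ih
    · intro b _ hb
      rcases hb.lt_or_gt with h | h
      · rw [hA h Fin.castSucc_lt_succ, zero_mul]
      · rw [repr_splitVector_eq_zero_of_gt hA θ _ _ h, mul_zero]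

theorem exists_split_basis {A : End F V} {v w : Basis (Fin (d + 1)) F V} {θ : Fin (d + 1) → F}
    (hv : LinearMap.toMatrix v v A = diagonal θ)
    (hA : IsUpperHessenberg (LinearMap.toMatrix w w A))
    (hne : ∀ i j, i ⋖ j → LinearMap.toMatrix w w A j i ≠ 0) :
    ∃ u : Basis (Fin (d + 1)) F V,
      (w.toMatrix u).IsUpperTriangular ∧ (v.toMatrix u).IsLowerTriangular := by
  have upper : (w.toMatrix (splitVector A θ (w 0))).IsUpperTriangular :=
    fun a b => repr_splitVector_eq_zero_of_gt hA θ b a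
  have hdet : IsUnit (w.det (splitVector A θ (w 0))) := by
    rw [isUnit_iff_ne_zero, Basis.det_apply, det_of_isUpperTriangular upper]
    exact Finset.prod_ne_zero_iff.2 fun i _ => repr_splitVector_self_ne_zero hA hne θ i
  obtain ⟨hli, hspan⟩ := w.is_basis_iff_det.2 hdet
  refine ⟨Basis.mk hli hspan.ge, ?_, ?_⟩
  · rwa [Basis.coe_mk]
  · rw [Basis.coe_mk]
    exact fun a b => repr_splitVector_eq_zero_of_lt hv (w 0) b a

end SplitBasis

section TransposedChangeOfBasis

variable {ι R M : Type*} [CommRing R] [AddCommGroup M] [Module R M]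

theorem transpose_toMatrix_mul_transpose_toMatrix [Fintype ι] [DecidableEq ι] (u v : Basis ι R M) :
    (u.toMatrix v)ᵀ * (v.toMatrix u)ᵀ = 1 := by
  rw [← transpose_mul, v.toMatrix_mul_toMatrix_flip, transpose_one]

theorem transpose_toMatrix_conj [Fintype ι] [DecidableEq ι] (u v : Basis ι R M) (f : End R M) :
    (v.toMatrix u)ᵀ * (LinearMap.toMatrix v v f)ᵀ * (u.toMatrix v)ᵀ =
      (LinearMap.toMatrix u u f)ᵀ := by
  rw [← transpose_mul, ← transpose_mul, ← mul_assoc,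
    basis_toMatrix_mul_linearMap_toMatrix_mul_basis_toMatrix]

theorem isUpperTriangular_transpose_toMatrix [Finite ι] [LinearOrder ι] {u v : Basis ι R M}
    (hu : (v.toMatrix u).IsLowerTriangular) : (u.toMatrix v)ᵀ.IsUpperTriangular := by
  have := Fintype.ofFinite ι
  exact isUpperTriangular_of_mul_eq_one hu.transpose (transpose_toMatrix_mul_transpose_toMatrix v u)

end TransposedChangeOfBasis

theorem mul_eq_mul_of_sum_Iic_mul_sub_eq
    {R : Type*} [CommRing R] [IsDomain R] {d : ℕ} {θ g : Fin (d + 1) → R}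
    (hsum : ∀ i : Fin d, ∑ h ∈ Finset.Iic i.castSucc, θ h ≠ 0)
    (hg : ∀ i : Fin d, (∑ h ∈ Finset.Iic i.castSucc, g h) * (θ i.castSucc - θ i.succ) =
      (∑ h ∈ Finset.Iic i.castSucc, θ h) * (g i.castSucc - g i.succ)) (i : Fin (d + 1)) :
    θ 0 * g i = g 0 * θ i := by
  induction i using WellFoundedLT.induction with
  | ind i ih =>
    cases i using Fin.cases with
    | zero => exact mul_comm _ _
    | succ i =>
      have partial_sums : θ 0 * ∑ h ∈ Finset.Iic i.castSucc, g h =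
          g 0 * ∑ h ∈ Finset.Iic i.castSucc, θ h := by
        rw [Finset.mul_sum, Finset.mul_sum]
        exact Finset.sum_congr rfl fun h hh =>
          ih h ((Finset.mem_Iic.1 hh).trans_lt Fin.castSucc_lt_succ)
      refine mul_left_cancel₀ (hsum i) ?_
      linear_combination θ 0 * hg i - (θ i.castSucc - θ i.succ) * partial_sums +
        (∑ h ∈ Finset.Iic i.castSucc, θ h) * ih i.castSucc Fin.castSucc_lt_succ

section LeonardSystem

variable {F V : Type*} [Field F] [AddCommGroup V] [Module F V] {d : ℕ}
  {A As B : End F V} {E Es : Fin (d + 1) → End F V} {θ θs : Fin (d + 1) → F}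
  {v : Basis (Fin (d + 1)) F V}

/-- `v` is a basis of eigenvectors of `A` with distinct eigenvalues `θ i`, and `E i` is the
projection onto the line of `v i` along the other basis vectors. -/
structure IsEigenbasis (A : End F V) (E : Fin (d + 1) → End F V) (θ : Fin (d + 1) → F)
    (v : Basis (Fin (d + 1)) F V) : Prop where
  eigenvalue_injective : Function.Injective θ
  apply_basis (i : Fin (d + 1)) : A (v i) = θ i • v i
  idempotent_apply (i : Fin (d + 1)) (x : V) : E i x = v.repr x i • v i

theorem IsPrimitiveIdempotents.exists_isEigenbasis (hE : IsPrimitiveIdempotents A E)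
    (hd : finrank F V = d + 1) (hθ : ∀ i, IsEigenvalueOf A (LinearMap.range (E i)) (θ i)) :
    ∃ v, IsEigenbasis A E θ v := by
  obtain ⟨t, ht, hev, hE_self, hE_ne⟩ := hE
  choose x hx using fun i => (hev i).exists_hasEigenvector
  have hx_mem (i : Fin (d + 1)) : x i ∈ A.eigenspace (θ i) := by
    rw [← (hθ i).2]
    exact ⟨x i, hE_self i _ (hx i).1⟩
  have ht_eq : t = θ := funext fun i => smul_left_injective F (hx i).2 <|
    (hx i).apply_eq_smul.symm.trans (End.mem_eigenspace_iff.1 (hx_mem i))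
  let v := basisOfLinearIndependentOfCardEqFinrank
    (End.eigenvectors_linearIndependent' A t ht x hx) (by simp [hd])
  have hvx (i : Fin (d + 1)) : v i = x i := by simp [v]
  have hEv (i j : Fin (d + 1)) : E i (v j) = if j = i then v j else 0 := by
    rw [hvx]
    split_ifs with hji
    · exact hE_self i _ (hji ▸ (hx j).1)
    · exact hE_ne i j (Ne.symm hji) _ (hx j).1
  refine ⟨v, ht_eq ▸ ht, fun i => ?_, fun i y => ?_⟩
  · rw [hvx]
    exact End.mem_eigenspace_iff.1 (hx_mem i)
  · conv_lhs => rw [← v.sum_repr y]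
    simp only [map_sum, map_smul, hEv, smul_ite, smul_zero, Finset.sum_ite_eq', Finset.mem_univ,
      if_true]

theorem IsEigenbasis.toMatrix_eq_diagonal (hv : IsEigenbasis A E θ v) :
    LinearMap.toMatrix v v A = diagonal θ := by
  ext i j
  rcases eq_or_ne i j with rfl | hij
  · simp [LinearMap.toMatrix_apply, hv.apply_basis]
  · simp [LinearMap.toMatrix_apply, hv.apply_basis, hij]

theorem IsEigenbasis.trace_mul (hv : IsEigenbasis A E θ v) (B : End F V) (i : Fin (d + 1)) :
    LinearMap.trace F V (E i * B) = LinearMap.toMatrix v v B i i := by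
  have hEB : E i * B = (v.coord i ∘ₗ B).smulRight (v i) :=
    LinearMap.ext fun x => hv.idempotent_apply i (B x)
  have := Module.Free.of_basis v
  have := Module.Finite.of_basis v
  rw [hEB, LinearMap.trace_smulRight, LinearMap.toMatrix_apply]
  rfl

theorem IsEigenbasis.mul_mul_eq_zero_iff (hv : IsEigenbasis A E θ v) {i j : Fin (d + 1)} :
    E i * B * E j = 0 ↔ LinearMap.toMatrix v v B i j = 0 := by
  rw [LinearMap.toMatrix_apply]
  refine ⟨fun h => ?_, fun h => LinearMap.ext fun x => ?_⟩
  · simpa [hv.idempotent_apply, v.ne_zero] using LinearMap.congr_fun h (v j)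
  · simp [hv.idempotent_apply, h]

theorem IsEigenbasis.isUpperHessenberg (hv : IsEigenbasis A E θ v)
    (hB : ActsIrredTridiagonally E B) : IsUpperHessenberg (LinearMap.toMatrix v v B) :=
  fun a b c hbc hca => hv.mul_mul_eq_zero_iff.1 <| hB.1 a b <| by
    rw [lt_abs]
    omega

theorem IsEigenbasis.isUpperHessenberg_transpose (hv : IsEigenbasis A E θ v)
    (hB : ActsIrredTridiagonally E B) : IsUpperHessenberg (LinearMap.toMatrix v v B)ᵀ :=
  fun a b c hbc hca => hv.mul_mul_eq_zero_iff.1 <| hB.1 b a <| by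
    rw [lt_abs]
    omega

theorem IsEigenbasis.toMatrix_ne_zero_of_covBy (hv : IsEigenbasis A E θ v)
    (hB : ActsIrredTridiagonally E B) {i j : Fin (d + 1)} (hij : i ⋖ j) :
    LinearMap.toMatrix v v B i j ≠ 0 ∧ LinearMap.toMatrix v v B j i ≠ 0 := by
  have hval : (i : ℕ) + 1 = j := Nat.covBy_iff_add_one_eq.1 (Fin.covBy_iff.1 hij)
  have hdist : |(i : ℤ) - j| = 1 := by
    rw [← hval, Nat.cast_succ, sub_add_cancel_left, abs_neg, abs_one]
  exact ⟨mt hv.mul_mul_eq_zero_iff.2 (hB.2 i j hdist),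
    mt hv.mul_mul_eq_zero_iff.2 (hB.2 j i (abs_sub_comm (i : ℤ) j ▸ hdist))⟩

section SplitBasisEntries

variable {u : Basis (Fin (d + 1)) F V} (hv : IsEigenbasis A E θ v)
include hv

theorem IsEigenbasis.toMatrix_apply_self_of_isUpperTriangular
    (hu : (v.toMatrix u).IsUpperTriangular) (a : Fin (d + 1)) :
    LinearMap.toMatrix u u A a a = θ a := by
  rw [← basis_toMatrix_mul_linearMap_toMatrix_mul_basis_toMatrix u v u v A, hv.toMatrix_eq_diagonal,
    conj_diagonal_apply_self hu (v.toMatrix_mul_toMatrix_flip u)]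

theorem IsEigenbasis.sum_trace_sub_mul_of_isUpperTriangular
    (hu : (v.toMatrix u).IsUpperTriangular) (hB : ActsIrredTridiagonally E B)
    {i j : Fin (d + 1)} (hij : i ⋖ j) :
    (∑ h ∈ Finset.Iic i, LinearMap.trace F V (E h * B) -
      ∑ h ∈ Finset.Iic i, LinearMap.toMatrix u u B h h) * (θ i - θ j) =
      LinearMap.toMatrix u u B j i * LinearMap.toMatrix u u A i j := by
  have key := (hv.isUpperHessenberg hB).sum_diag_sub_sum_diag_conj_mul hu
    (v.toMatrix_mul_toMatrix_flip u) θ hij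
  rw [← hv.toMatrix_eq_diagonal] at key
  simpa only [basis_toMatrix_mul_linearMap_toMatrix_mul_basis_toMatrix, hv.trace_mul] using key

theorem IsEigenbasis.toMatrix_ne_zero_of_isUpperTriangular
    (hu : (v.toMatrix u).IsUpperTriangular) (hB : ActsIrredTridiagonally E B)
    {i j : Fin (d + 1)} (hij : i ⋖ j) : LinearMap.toMatrix u u B j i ≠ 0 := by
  rw [← basis_toMatrix_mul_linearMap_toMatrix_mul_basis_toMatrix u v u v B]
  exact (hv.isUpperHessenberg hB).conj_apply_ne_zero hu (v.toMatrix_mul_toMatrix_flip u) hij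
    (hv.toMatrix_ne_zero_of_covBy hB hij).2

theorem IsEigenbasis.toMatrix_apply_self_of_isLowerTriangular
    (hu : (v.toMatrix u).IsLowerTriangular) (a : Fin (d + 1)) :
    LinearMap.toMatrix u u A a a = θ a := by
  rw [← transpose_apply (LinearMap.toMatrix u u A), ← transpose_toMatrix_conj u v,
    hv.toMatrix_eq_diagonal, diagonal_transpose,
    conj_diagonal_apply_self (isUpperTriangular_transpose_toMatrix hu)
      (transpose_toMatrix_mul_transpose_toMatrix u v)]

theorem IsEigenbasis.sum_trace_sub_mul_of_isLowerTriangular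
    (hu : (v.toMatrix u).IsLowerTriangular) (hB : ActsIrredTridiagonally E B)
    {i j : Fin (d + 1)} (hij : i ⋖ j) :
    (∑ h ∈ Finset.Iic i, LinearMap.trace F V (E h * B) -
      ∑ h ∈ Finset.Iic i, LinearMap.toMatrix u u B h h) * (θ i - θ j) =
      LinearMap.toMatrix u u B i j * LinearMap.toMatrix u u A j i := by
  have key := (hv.isUpperHessenberg_transpose hB).sum_diag_sub_sum_diag_conj_mul
    (isUpperTriangular_transpose_toMatrix hu) (transpose_toMatrix_mul_transpose_toMatrix u v) θ hij
  rw [← diagonal_transpose, ← hv.toMatrix_eq_diagonal] at key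
  simpa only [transpose_toMatrix_conj, transpose_apply, hv.trace_mul] using key

theorem IsEigenbasis.toMatrix_ne_zero_of_isLowerTriangular
    (hu : (v.toMatrix u).IsLowerTriangular) (hB : ActsIrredTridiagonally E B)
    {i j : Fin (d + 1)} (hij : i ⋖ j) : LinearMap.toMatrix u u B i j ≠ 0 := by
  rw [← transpose_apply (LinearMap.toMatrix u u B), ← transpose_toMatrix_conj u v]
  exact (hv.isUpperHessenberg_transpose hB).conj_apply_ne_zero
    (isUpperTriangular_transpose_toMatrix hu) (transpose_toMatrix_mul_transpose_toMatrix u v) hij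
    (hv.toMatrix_ne_zero_of_covBy hB hij).1

end SplitBasisEntries

-- `φ` is the entry `φ_{i+1}` of the first split sequence, that is, the product of the entries of
-- `A` and `A*` coupling `u_i` and `u_{i+1}` in the split basis `u`.
theorem IsLeonardSystem.exists_split_entry (hL : IsLeonardSystem A E As Es)
    (hθ : ∀ i, IsEigenvalueOf A (LinearMap.range (E i)) (θ i))
    (hθs : ∀ i, IsEigenvalueOf As (LinearMap.range (Es i)) (θs i)) (i : Fin d) :
    ∃ φ : F, φ ≠ 0 ∧
      (∑ h ∈ Finset.Iic i.castSucc, LinearMap.trace F V (Es h * A) -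
        ∑ h ∈ Finset.Iic i.castSucc, θ h) * (θs i.castSucc - θs i.succ) = φ ∧
      (∑ h ∈ Finset.Iic i.castSucc, LinearMap.trace F V (E h * As) -
        ∑ h ∈ Finset.Iic i.castSucc, θs h) * (θ i.castSucc - θ i.succ) = φ := by
  obtain ⟨v, hv⟩ := hL.idempotents.exists_isEigenbasis hL.finrank_eq hθ
  obtain ⟨w, hw⟩ := hL.idempotents_star.exists_isEigenbasis hL.finrank_eq hθs
  obtain ⟨u, hwu, hvu⟩ := exists_split_basis hv.toMatrix_eq_diagonal
    (hw.isUpperHessenberg hL.tridiagonal)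
    fun a b hab => (hw.toMatrix_ne_zero_of_covBy hL.tridiagonal hab).2
  have hij := castSucc_covBy_succ i
  have sum_A := hw.sum_trace_sub_mul_of_isUpperTriangular hwu hL.tridiagonal hij
  have sum_As := hv.sum_trace_sub_mul_of_isLowerTriangular hvu hL.tridiagonal_star hij
  simp only [hv.toMatrix_apply_self_of_isLowerTriangular hvu] at sum_A
  simp only [hw.toMatrix_apply_self_of_isUpperTriangular hwu] at sum_As
  exact ⟨_, mul_ne_zero (hw.toMatrix_ne_zero_of_isUpperTriangular hwu hL.tridiagonal hij)
    (hv.toMatrix_ne_zero_of_isLowerTriangular hvu hL.tridiagonal_star hij), sum_A,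
    sum_As.trans (mul_comm _ _)⟩

theorem IsLeonardSystem.rev_star (hL : IsLeonardSystem A E As Es) :
    IsLeonardSystem A E As fun i => Es i.rev where
  finrank_eq := hL.finrank_eq
  multiplicityFree := hL.multiplicityFree
  multiplicityFree_star := hL.multiplicityFree_star
  idempotents := hL.idempotents
  idempotents_star := by
    obtain ⟨t, ht, hev, hE_self, hE_ne⟩ := hL.idempotents_star
    exact ⟨fun i => t i.rev, ht.comp Fin.rev_injective, fun i => hev _, fun i => hE_self _,
      fun i j hij => hE_ne _ _ (Fin.rev_injective.ne hij)⟩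
  tridiagonal := by
    have dist_rev (i j : Fin (d + 1)) : |(i.rev : ℤ) - (j.rev : ℤ)| = |(i : ℤ) - (j : ℤ)| := by
      rw [abs_sub_comm (i : ℤ)]
      congr 1
      simp only [Fin.val_rev]
      omega
    exact ⟨fun i j hij => hL.tridiagonal.1 _ _ (by rwa [dist_rev]),
      fun i j hij => hL.tridiagonal.2 _ _ (by rwa [dist_rev])⟩
  tridiagonal_star := hL.tridiagonal_star

-- The dual intersection numbers `tr (E_h A*)` do not depend on the ordering of the `E*_i`, so
-- comparing the system with its reversal eliminates them.
theorem IsLeonardSystem.sum_mul_sub_eq_of_isBipartite (hL : IsLeonardSystem A E As Es)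
    (hbip : IsBipartite A Es) (hθ : ∀ i, IsEigenvalueOf A (LinearMap.range (E i)) (θ i))
    (hθs : ∀ i, IsEigenvalueOf As (LinearMap.range (Es i)) (θs i)) (i : Fin d) :
    ∑ h ∈ Finset.Iic i.castSucc, θ h ≠ 0 ∧
      (∑ h ∈ Finset.Iic i.castSucc, (θs h.rev - θs h)) * (θ i.castSucc - θ i.succ) =
        (∑ h ∈ Finset.Iic i.castSucc, θ h) *
          ((θs i.castSucc.rev - θs i.castSucc) - (θs i.succ.rev - θs i.succ)) := by
  obtain ⟨φ, hφ, sum_A, sum_As⟩ := hL.exists_split_entry hθ hθs i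
  obtain ⟨ψ, -, sum_A_rev, sum_As_rev⟩ := hL.rev_star.exists_split_entry hθ (fun i => hθs i.rev) i
  have htrace (h : Fin (d + 1)) : LinearMap.trace F V (Es h * A) = 0 := hbip h
  simp only [htrace, Finset.sum_const_zero, zero_sub] at sum_A sum_A_rev
  refine ⟨fun hsum => hφ ?_, ?_⟩
  · rw [← sum_A, hsum, neg_zero, zero_mul]
  · rw [Finset.sum_sub_distrib]
    linear_combination sum_As - sum_As_rev - sum_A + sum_A_rev

theorem IsLeonardSystem.sum_eigenvalue_eq_zero_of_isBipartite (hL : IsLeonardSystem A E As Es)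
    (hbip : IsBipartite A Es) (hθ : ∀ i, IsEigenvalueOf A (LinearMap.range (E i)) (θ i))
    (hθs : ∀ i, IsEigenvalueOf As (LinearMap.range (Es i)) (θs i)) : ∑ i, θ i = 0 := by
  obtain ⟨v, hv⟩ := hL.idempotents.exists_isEigenbasis hL.finrank_eq hθ
  obtain ⟨w, hw⟩ := hL.idempotents_star.exists_isEigenbasis hL.finrank_eq hθs
  calc ∑ i, θ i = (LinearMap.toMatrix v v A).trace := by
        rw [hv.toMatrix_eq_diagonal, trace_diagonal]
    _ = (LinearMap.toMatrix w w A).trace := by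
        rw [← LinearMap.trace_eq_matrix_trace, ← LinearMap.trace_eq_matrix_trace]
    _ = 0 := Finset.sum_eq_zero fun i _ => (hw.trace_mul A i).symm.trans (hbip i)

theorem IsLeonardSystem.eigenvalue_star_injective (hL : IsLeonardSystem A E As Es)
    (hθs : ∀ i, IsEigenvalueOf As (LinearMap.range (Es i)) (θs i)) : Function.Injective θs := by
  obtain ⟨w, hw⟩ := hL.idempotents_star.exists_isEigenbasis hL.finrank_eq hθs
  exact hw.eigenvalue_injective

theorem IsLeonardSystem.exists_star_sub_eq_mul (hL : IsLeonardSystem A E As Es)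
    (hbip : IsBipartite A Es) (hθ : ∀ i, IsEigenvalueOf A (LinearMap.range (E i)) (θ i))
    (hθs : ∀ i, IsEigenvalueOf As (LinearMap.range (Es i)) (θs i)) :
    ∃ c : F, c ≠ 0 ∧ ∀ i, θs i.rev - θs i = c * θ i := by
  have sums := hL.sum_mul_sub_eq_of_isBipartite hbip hθ hθs
  have proportional := mul_eq_mul_of_sum_Iic_mul_sub_eq (g := fun i => θs i.rev - θs i)
    (fun i => (sums i).1) fun i => (sums i).2
  rcases d with _ | d
  · have hθ_zero := hL.sum_eigenvalue_eq_zero_of_isBipartite hbip hθ hθs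
    rw [Fin.sum_univ_one] at hθ_zero
    refine ⟨1, one_ne_zero, fun i => ?_⟩
    rw [Fin.fin_one_eq_zero i.rev, Fin.fin_one_eq_zero i, sub_self, hθ_zero, mul_zero]
  · have hθ_ne : θ 0 ≠ 0 := by
      have hIic : Finset.Iic (0 : Fin (d + 2)) = {0} := Finset.Iic_bot
      simpa [hIic] using (sums 0).1
    have hθs_ne : θs (Fin.rev 0) - θs 0 ≠ 0 :=
      sub_ne_zero.2 <| (hL.eigenvalue_star_injective hθs).ne (by simp)
    refine ⟨_, div_ne_zero hθs_ne hθ_ne, fun i => ?_⟩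
    rw [div_mul_eq_mul_div, eq_div_iff hθ_ne, ← proportional, mul_comm]

end LeonardSystem

section Recursion

variable {F : Type*} [Field F] {d : ℕ} {θ θs : Fin (d + 1) → F} {i j : Fin (d + 1)} {y : F}
  (hrev : ∀ i, θ i.rev = -θ i)
  (hrel : ∀ i : Fin d, θ i.castSucc * (θs i.succ.rev - θs i.succ) =
    θ i.succ * (θs i.castSucc.rev - θs i.castSucc))
include hrev

theorem recComputes_of_recComputes_rev (h : RecComputes θs j (θ j) i.rev (θ i.rev)) :
    RecComputes θs j (θ j) i (θ i) := by
  simpa only [Fin.rev_rev, hrev, neg_neg] using h.reflect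

include hrel

theorem RecComputes.eq_eigenvalue (h : RecComputes θs j (θ j) i y) : y = θ i := by
  induction h with
  | start => rfl
  | reflect i y _ ih => rw [hrev, ih]
  | up i y _ hne ih => rw [ih, div_eq_iff hne, hrel]
  | down i y _ hne ih => rw [ih, div_eq_iff hne, hrel]

variable (hθs : Function.Injective θs)
include hθs

theorem recComputes_zero_of_lt_rev (hi : i < i.rev) (h : RecComputes θs j (θ j) i (θ i)) :
    RecComputes θs j (θ j) 0 (θ 0) := by
  induction i using Fin.induction with
  | zero => exact h
  | succ i ih =>
    have hi_rev : i.castSucc < i.castSucc.rev :=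
      (Fin.castSucc_lt_succ.trans hi).trans (Fin.rev_strictAnti Fin.castSucc_lt_succ)
    have step := h.down i _ (sub_ne_zero.2 (hθs.ne hi.ne'))
    exact ih hi_rev (step.eq_eigenvalue hrev hrel ▸ step)

theorem recComputes_of_le_rev (hi : i ≤ i.rev) (h : RecComputes θs j (θ j) 0 (θ 0)) :
    RecComputes θs j (θ j) i (θ i) := by
  induction i using Fin.induction with
  | zero => exact h
  | succ i ih =>
    have hi_rev : i.castSucc < i.castSucc.rev :=
      (Fin.castSucc_lt_succ.trans_le hi).trans (Fin.rev_strictAnti Fin.castSucc_lt_succ)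
    have step := (ih hi_rev.le).up i _ (sub_ne_zero.2 (hθs.ne hi_rev.ne'))
    exact step.eq_eigenvalue hrev hrel ▸ step

theorem recComputes_eigenvalue (hj : j.rev ≠ j) (i : Fin (d + 1)) :
    RecComputes θs j (θ j) i (θ i) := by
  have start_rev_rev : RecComputes θs j (θ j) j.rev.rev (θ j.rev.rev) := by
    rw [Fin.rev_rev]
    exact .start
  have zero : RecComputes θs j (θ j) 0 (θ 0) := by
    rcases hj.lt_or_gt with h | h
    · exact recComputes_zero_of_lt_rev hrev hrel hθs (by rwa [Fin.rev_rev])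
        (recComputes_of_recComputes_rev hrev start_rev_rev)
    · exact recComputes_zero_of_lt_rev hrev hrel hθs h .start
  rcases le_total i i.rev with h | h
  · exact recComputes_of_le_rev hrev hrel hθs h zero
  · exact recComputes_of_recComputes_rev hrev
      (recComputes_of_le_rev hrev hrel hθs (by rwa [Fin.rev_rev]) zero)

end Recursion

end Leonard

/-- For `i : Fin d`, the indices `i.castSucc`, `i.succ`, `i.castSucc.rev`, `i.succ.rev` of
`Fin (d + 1)` are `i`, `i + 1`, `d - i`, `d - i - 1`. -/
theorem proposition9p4 {F V : Type*} [Field F] [AddCommGroup V] [Module F V] {d : ℕ}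
    (A As : Module.End F V) (E Es : Fin (d + 1) → Module.End F V)
    (hL : Leonard.IsLeonardSystem A E As Es) (hbip : Leonard.IsBipartite A Es)
    (θ θs : Fin (d + 1) → F)
    (hθ : ∀ i, Leonard.IsEigenvalueOf A (LinearMap.range (E i)) (θ i))
    (hθs : ∀ i, Leonard.IsEigenvalueOf As (LinearMap.range (Es i)) (θs i)) :
    (∀ i : Fin d, θ i.castSucc * (θs i.succ.rev - θs i.succ) =
      θ i.succ * (θs i.castSucc.rev - θs i.castSucc)) ∧
    (∀ j : Fin (d + 1), θ j ≠ 0 → ∀ (i : Fin (d + 1)) (y : F),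
      Leonard.RecComputes θs j (θ j) i y ↔ y = θ i) := by
  obtain ⟨c, hc, hproportional⟩ := hL.exists_star_sub_eq_mul hbip hθ hθs
  have hrev (i : Fin (d + 1)) : θ i.rev = -θ i := by
    refine mul_left_cancel₀ hc ?_
    rw [mul_neg, ← hproportional, ← hproportional, Fin.rev_rev, neg_sub]
  have hrel (i : Fin d) : θ i.castSucc * (θs i.succ.rev - θs i.succ) =
      θ i.succ * (θs i.castSucc.rev - θs i.castSucc) := by
    rw [hproportional, hproportional]
    ring
  have hj_rev (j : Fin (d + 1)) (hj : θ j ≠ 0) : j.rev ≠ j := by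
    intro h
    have := hproportional j
    rw [h, sub_self] at this
    exact mul_ne_zero hc hj this.symm
  refine ⟨hrel, fun j hj i y => ⟨fun h => h.eq_eigenvalue hrev hrel, ?_⟩⟩
  rintro rfl
  exact Leonard.recComputes_eigenvalue hrev hrel (hL.eigenvalue_star_injective hθs) (hj_rev j hj) i
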